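/- Let $H_{\omega_1}$ be the set of all sets whose transitive closure is countable. Let $\mathcal{L}^*$ be the first-order signature that has an $n$-ary predicate symbol $R_\phi$ for each first-order formula $\phi(x_1,\dots,x_n)$ in the signature $\{\in\}$ that is logically equivalent to a bounded ($\Delta_0$) formula, that is, to a formula all of whose quantifiers are of the form $\forall x\in y$ or $\exists x\in y$. Interpret $R_\phi$ on $H_{\omega_1}$ by $R_\phi^V=\{(a_1,\dots,a_n)\in H_{\omega_1}^n : V\models\phi(a_1,\dots,a_n)\}$, where $V$ is the universe of sets. Let $T$ be the first-order theory of the structure $\langle H_{\omega_1},\,R_\phi^V : R_\phi\in\mathcal{L}^*\rangle$ in the signature $\mathcal{L}^*\cup H_{\omega_1}$, which has in addition a constant symbol for each element of $H_{\omega_1}$, interpreted by that element. Then $T$ is not model complete: there are models $\mathcal{M}$ and $\mathcal{N}$ of $T$ such that $\mathcal{M}$ is a substructure of $\mathcal{N}$ but not an elementary substructure of $\mathcal{N}$. -/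

import Mathlib

open FirstOrder FirstOrder.Language

universe u v

/-- Relation symbols of the language of set theory: one binary symbol `∈`. -/
inductive MemRel : ℕ → Type
  | mem : MemRel 2

/-- The first-order language `{∈}` of set theory (with equality as a logical symbol). -/
def memLang : FirstOrder.Language.{0, 0} := ⟨fun _ => Empty, MemRel⟩

/-- The symbol `∈` of `memLang`. -/
def memSym : memLang.Relations 2 := MemRel.mem

/-- The universe of sets as an `{∈}`-structure. -/
instance ZFSet.memStructure : memLang.Structure ZFSet.{u} where
  funMap := fun f => f.elim
  RelMap := fun R => match R with
    | MemRel.mem => fun x => x 0 ∈ x 1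

/-- The formula `x ∈ v`, where `x` is the last bound variable (the one with index `n`) and `v` is a
variable different from it. -/
def newMem {α : Type} {n : ℕ} (v : α ⊕ Fin n) : memLang.BoundedFormula α (n + 1) :=
  memSym.boundedFormula₂ (Term.var (Sum.inr (Fin.last n)))
    (Term.var (Sum.map id Fin.castSucc v))

/-- Bounded (`Δ₀`) formulas in the signature `{∈}`: built from atomic formulas by means of
propositional connectives and the bounded quantifiers `∀ x ∈ v` and `∃ x ∈ v`, with `v` a variable
different from `x`. -/
inductive IsBounded {α : Type} : ∀ {n : ℕ}, memLang.BoundedFormula α n → Prop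
  | falsum {n : ℕ} : IsBounded (BoundedFormula.falsum : memLang.BoundedFormula α n)
  | equal {n : ℕ} (s t : memLang.Term (α ⊕ Fin n)) : IsBounded (BoundedFormula.equal s t)
  | rel {n k : ℕ} (R : memLang.Relations k) (ts : Fin k → memLang.Term (α ⊕ Fin n)) :
      IsBounded (BoundedFormula.rel R ts)
  | imp {n : ℕ} {φ ψ : memLang.BoundedFormula α n} :
      IsBounded φ → IsBounded ψ → IsBounded (φ.imp ψ)
  | ballMem {n : ℕ} (v : α ⊕ Fin n) {φ : memLang.BoundedFormula α (n + 1)} :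
      IsBounded φ → IsBounded ((newMem v).imp φ).all
  | bexMem {n : ℕ} (v : α ⊕ Fin n) {φ : memLang.BoundedFormula α (n + 1)} :
      IsBounded φ → IsBounded (newMem v ⊓ φ).ex

/-- The signature `L*`: it has an `n`-ary predicate symbol `R_φ` for each `{∈}`-formula
`φ(x₁, …, xₙ)` that is logically equivalent to a bounded formula, and no other symbol. -/
def starLang : FirstOrder.Language.{0, 0} where
  Functions := fun _ => Empty
  Relations := fun n =>
    {φ : memLang.Formula (Fin n) //
      ∃ ψ : memLang.Formula (Fin n), IsBounded ψ ∧ φ ⇔[(∅ : memLang.Theory)] ψ}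

/-- `H_{ω₁}`, the sets whose transitive closure is countable. The members of the transitive closure
of `x` are the `y` with `y ∈ x₁ ∈ ⋯ ∈ x` for some finite chain of memberships. -/
def HC : Type (u + 1) :=
  {x : ZFSet.{u} // {y : ZFSet.{u} | Relation.TransGen (· ∈ ·) y x}.Countable}

/-- The `L*`-structure `(H_{ω₁}, R_φ^V : R_φ ∈ L*)`: the symbol `R_φ` is interpreted by the tuples
of elements of `H_{ω₁}` that satisfy `φ` in the universe `V` of all sets. -/
instance HC.starStructure : starLang.Structure HC.{u} where
  funMap := fun f => f.elim
  RelMap := fun R x => R.1.Realize (fun i => (x i).1)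

/-- `T` is model complete: whenever `M` and `N` are models of `T` and `M` is a substructure of `N`,
then `M` is an elementary substructure of `N`. (First-order structures are non-empty.) -/
def IsModelComplete {L : FirstOrder.Language.{u, v}} (T : L.Theory) : Prop :=
  ∀ (N : Type (max u v)) [L.Structure N] [Nonempty N] (M : L.Substructure N) [Nonempty M],
    N ⊨ T → M ⊨ T → M.IsElementary

/-- The first-order theory, in the signature `L* ∪ H_{ω₁}` with a constant for each element of
`H_{ω₁}`, of the structure `(H_{ω₁}, R_φ^V : R_φ ∈ L*)` in which each constant denotes itself. -/
def theoryHC : (starLang[[HC.{u}]]).Theory :=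
  starLang.elementaryDiagram HC.{u}

namespace HC

/-! The obstruction is a Σ₁ set with no Σ₁ complement, even with parameters. Call a property of
enumerations `f` of countable transitive sets coded if an infinitary propositional formula with
atoms `f i ∈ f j` expresses it. Such a formula is itself a hereditarily countable set. Over a
transitive range bounded quantifiers become countable connectives, so every `L*` relation is coded
(`Coded.relMap`), as is equality with a parameter (`Coded.eq_const`). Projections of coded
properties play the role of Σ₁ sets. `Univ` is universal for them and first-order definable
(`dfn_univ`), and by Russell's argument the complement of its diagonal D is not a projection.

Coded properties are closed under finite disjunction, so some ultrapower has a point A outside D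
that avoids every projection disjoint from D (`exists_generic`). The atomic diagram of this
ultrapower is then finitely satisfiable together with "A is in D" (`exists_finite_approx`):
otherwise a finite part of it would define a projection disjoint from D and containing A. A second
ultrapower realizes all of this at once (`exists_embedding`). The resulting embedding of models of
`T` moves A into D, so it is not elementary. -/

instance : Membership HC.{u} HC.{u} := ⟨fun b a => a.1 ∈ b.1⟩

/-! ### Closure properties of the hereditarily countable sets. -/

/-- A member of a hereditarily countable set is hereditarily countable. -/
theorem exists_of_mem {a : HC.{u}} {y : ZFSet.{u}} (h : y ∈ a.1) : ∃ b : HC.{u}, b.1 = y :=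
  ⟨⟨y, a.2.mono fun _ hz => Relation.TransGen.trans hz (Relation.TransGen.single h)⟩, rfl⟩

theorem ext {a b : HC.{u}} (h : ∀ z : HC.{u}, z ∈ a ↔ z ∈ b) : a = b := by
  apply Subtype.ext
  apply ZFSet.ext
  intro z
  constructor
  · intro hz
    obtain ⟨c, rfl⟩ := exists_of_mem hz
    exact (h c).1 hz
  · intro hz
    obtain ⟨c, rfl⟩ := exists_of_mem hz
    exact (h c).2 hz

theorem wellFounded_mem : WellFounded (fun a b : HC.{u} => a ∈ b) :=
  InvImage.wf (fun a : HC.{u} => a.1) ZFSet.mem_wf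

theorem countable_transGen (a : HC.{u}) :
    {b : HC.{u} | Relation.TransGen (· ∈ ·) b a}.Countable := by
  refine Set.Countable.mono ?_ (a.2.preimage Subtype.val_injective)
  intro b hb
  exact Relation.TransGen.lift (r := fun c d : HC.{u} => c ∈ d) (fun c : HC.{u} => c.1)
    (fun _ _ h => h) _ _ hb

theorem countable_members (a : HC.{u}) : {b : HC.{u} | b ∈ a}.Countable :=
  (countable_transGen a).mono fun _ h => Relation.TransGen.single h

theorem exists_set (s : Set HC.{u}) (hs : s.Countable) : ∃ a : HC.{u}, ∀ z, z ∈ a ↔ z ∈ s := by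
  have := hs.to_subtype
  have : Small.{u} s := Countable.toSmall _
  let A : ZFSet.{u} := ZFSet.range (fun x : s => x.1.1)
  have hA : {y : ZFSet.{u} | Relation.TransGen (· ∈ ·) y A}.Countable := by
    refine Set.Countable.mono ?_ (Set.countable_iUnion (ι := s) fun x =>
      (x.1.2.insert x.1.1))
    intro y hy
    simp only [Set.mem_iUnion, Set.mem_insert_iff]
    obtain ⟨z, hz, hzA⟩ := Relation.TransGen.tail'_iff.1 hy
    obtain ⟨x, rfl⟩ := ZFSet.mem_range.1 hzA
    refine ⟨x, ?_⟩
    rcases Relation.reflTransGen_iff_eq_or_transGen.1 hz with h | h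
    · exact Or.inl h.symm
    · exact Or.inr h
  refine ⟨⟨A, hA⟩, fun z => ?_⟩
  change z.1 ∈ ZFSet.range (fun x : s => x.1.1) ↔ _
  rw [ZFSet.mem_range]
  constructor
  · rintro ⟨x, hx⟩
    rw [← Subtype.ext hx]
    exact x.2
  · intro hz
    exact ⟨⟨z, hz⟩, rfl⟩

/-- The hereditarily countable set with a given countable set of members. -/
noncomputable def ofCountable (s : Set HC.{u}) (hs : s.Countable) : HC.{u} :=
  (exists_set s hs).choose

@[simp]
theorem mem_ofCountable {s : Set HC.{u}} {hs : s.Countable} {z : HC.{u}} :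
    z ∈ ofCountable s hs ↔ z ∈ s :=
  (exists_set s hs).choose_spec z

theorem exists_transitive (s : Set HC.{u}) (hs : s.Countable) :
    ∃ T : HC.{u}, (∀ x ∈ s, x ∈ T) ∧ ∀ t ∈ T, ∀ x ∈ t, x ∈ T := by
  let R : Set HC.{u} := ⋃ x ∈ s, insert x {b | Relation.TransGen (· ∈ ·) b x}
  have hR : R.Countable := hs.biUnion fun x _ => (countable_transGen x).insert x
  refine ⟨ofCountable R hR, fun x hx => ?_, fun t ht x hx => ?_⟩
  · rw [mem_ofCountable]
    exact Set.mem_biUnion hx (Set.mem_insert _ _)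
  · rw [mem_ofCountable] at ht ⊢
    simp only [R, Set.mem_iUnion, Set.mem_insert_iff, Set.mem_ofPred_eq, exists_prop] at ht ⊢
    obtain ⟨y, hy, h⟩ := ht
    refine ⟨y, hy, Or.inr ?_⟩
    rcases h with rfl | h
    · exact Relation.TransGen.single hx
    · exact Relation.TransGen.head hx h

/-! ### Pairs and names for natural numbers. -/

/-- The empty set. -/
noncomputable def empty : HC.{u} := ofCountable ∅ Set.countable_empty

@[simp]
theorem notMem_empty (z : HC.{u}) : z ∉ empty := by simp [empty]

/-- The unordered pair `{a, b}`. -/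
noncomputable def upair (a b : HC.{u}) : HC.{u} := ofCountable {a, b} (Set.to_countable _)

@[simp]
theorem mem_upair {a b z : HC.{u}} : z ∈ upair a b ↔ z = a ∨ z = b := by simp [upair]

theorem eq_upair_iff {s a b : HC.{u}} : s = upair a b ↔ ∀ z, z ∈ s ↔ (z = a ∨ z = b) := by
  refine ⟨?_, fun h => ext fun z => by rw [h, mem_upair]⟩
  rintro rfl z
  exact mem_upair

theorem upair_inj {a b c d : HC.{u}} :
    upair a b = upair c d ↔ (a = c ∧ b = d) ∨ (a = d ∧ b = c) := by
  rw [eq_upair_iff]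
  simp only [mem_upair]
  constructor
  · intro h
    have h1 := h a
    have h2 := h b
    have h3 := h c
    have h4 := h d
    grind
  · grind

theorem upair_ne_empty (a b : HC.{u}) : upair a b ≠ empty := fun h =>
  notMem_empty a (h ▸ mem_upair.2 (Or.inl rfl))

/-- The ordered pair of Kuratowski. -/
noncomputable def pair (a b : HC.{u}) : HC.{u} := upair (upair a a) (upair a b)

theorem pair_inj {a b c d : HC.{u}} : pair a b = pair c d ↔ a = c ∧ b = d := by
  simp only [pair, upair_inj]
  grind

theorem empty_notMem_pair (a b : HC.{u}) : empty ∉ pair a b := by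
  rw [pair, mem_upair]
  rintro (h | h) <;> exact upair_ne_empty _ _ h.symm

theorem pair_ne_empty (a b : HC.{u}) : pair a b ≠ empty := upair_ne_empty _ _

/-- Zermelo's natural numbers, used as names for the members of a countable structure. -/
noncomputable def name : ℕ → HC.{u}
  | 0 => empty
  | n + 1 => upair (name n) (name n)

theorem name_injective : Function.Injective name.{u} := by
  intro m
  induction m with
  | zero =>
    intro n h
    cases n with
    | zero => rfl
    | succ n => exact absurd h.symm (upair_ne_empty _ _)
  | succ m ih =>
    intro n h
    cases n with
    | zero => exact absurd h (upair_ne_empty _ _)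
    | succ n =>
      have : name m = name n := by
        have := upair_inj.1 h
        tauto
      rw [ih this]

/-- The set of all names. -/
noncomputable def names : HC.{u} := ofCountable (Set.range name) (Set.countable_range _)

@[simp]
theorem mem_names {z : HC.{u}} : z ∈ names ↔ ∃ n, name n = z := by simp [names]

/-! ### Infinitary propositional formulas and their truth. -/

/-- The range of `f` is a transitive class. -/
def TransRange (f : ℕ → HC.{u}) : Prop := ∀ i, ∀ z ∈ f i, ∃ j, f j = z

/-- A hereditarily countable set is read as an infinitary propositional formula: a set containing
`∅` is the disjunction of the negations of its members, `∅` is true, and the pair of the names of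
`i` and `j` is the atom `f i ∈ f j`. The set `T` is transitive, and `S` consists of the true
formulas (among those in `T`). -/
structure Eval (f : ℕ → HC.{u}) (S T : HC.{u}) : Prop where
  trans : ∀ t ∈ T, ∀ s ∈ t, s ∈ T
  empty_mem : empty ∈ S
  compound : ∀ t ∈ T, empty ∈ t → (t ∈ S ↔ ∃ s ∈ t, s ∉ S)
  atom : ∀ i j, pair (name i) (name j) ∈ S ↔ f i ∈ f j

/-- `c` expresses the property `P` of enumerations of countable transitive sets. -/
def Codes (c : HC.{u}) (P : (ℕ → HC.{u}) → Prop) : Prop :=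
  ∀ f S T, TransRange f → Eval f S T → c ∈ T → (c ∈ S ↔ P f)

/-- `P` is expressed by an infinitary propositional formula. -/
def Coded (P : (ℕ → HC.{u}) → Prop) : Prop := ∃ c, Codes c P

open Classical in
/-- The truth value of an infinitary propositional formula. -/
noncomputable def val (f : ℕ → HC.{u}) : HC.{u} → Prop :=
  wellFounded_mem.fix fun t ih =>
    if empty ∈ t then ∃ s, ∃ h : s ∈ t, ¬ ih s h
    else t = empty ∨ ∃ i j, t = pair (name i) (name j) ∧ f i ∈ f j

theorem val_eq (f : ℕ → HC.{u}) (t : HC.{u}) :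
    val f t ↔ (empty ∈ t ∧ ∃ s ∈ t, ¬ val f s) ∨
      (empty ∉ t ∧ (t = empty ∨ ∃ i j, t = pair (name i) (name j) ∧ f i ∈ f j)) := by
  rw [val, WellFounded.fix_eq]
  by_cases h : empty ∈ t <;> simp [h]

theorem exists_eval (f : ℕ → HC.{u}) (c : HC.{u}) : ∃ S T, Eval f S T ∧ c ∈ T := by
  -- `Eval.atom` speaks of all atoms, whether or not they occur in `c`, so all of them are put into
  -- `T`.
  obtain ⟨T, hT, hT'⟩ := exists_transitive
    (insert c (insert empty (Set.range fun p : ℕ × ℕ => pair (name p.1) (name p.2))))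
    (((Set.countable_range _).insert _).insert _)
  have hS : {t | t ∈ T ∧ val f t}.Countable := (countable_members T).mono fun _ h => h.1
  refine ⟨ofCountable _ hS, T, ⟨hT', ?_, ?_, ?_⟩, hT c (Set.mem_insert _ _)⟩
  · rw [mem_ofCountable]
    refine ⟨hT _ (by simp), ?_⟩
    rw [val_eq]
    simp
  · intro t ht h
    simp only [mem_ofCountable, Set.mem_ofPred_eq, ht, true_and]
    rw [val_eq]
    simp only [h, true_and, not_true_eq_false, false_and, or_false]
    exact exists_congr fun s => and_congr_right fun hs => by simp [hT' t ht s hs]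
  · intro i j
    simp only [mem_ofCountable, Set.mem_ofPred_eq]
    rw [val_eq]
    have hp : pair (name i) (name j) ∈ T := hT _ (by simp)
    simp only [hp, empty_notMem_pair, true_and, false_and, false_or, not_false_eq_true,
      pair_ne_empty, pair_inj, name_injective.eq_iff]
    constructor
    · rintro ⟨k, l, ⟨rfl, rfl⟩, h⟩
      exact h
    · exact fun h => ⟨i, j, ⟨rfl, rfl⟩, h⟩

/-! ### Which properties of enumerations are coded. -/

namespace Coded

theorem congr {P Q : (ℕ → HC.{u}) → Prop} (hP : Coded P) (h : ∀ f, TransRange f → (P f ↔ Q f)) :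
    Coded Q := by
  obtain ⟨c, hc⟩ := hP
  exact ⟨c, fun f S T hf hE hcT => (hc f S T hf hE hcT).trans (h f hf)⟩

theorem atom (i j : ℕ) : Coded fun f : ℕ → HC.{u} => f i ∈ f j :=
  ⟨pair (name i) (name j), fun _ _ _ _ hE _ => hE.atom i j⟩

/-- This is the one connective built into the coding: adding `∅` to the set of codes forms the
disjunction of their negations. As `∅` itself counts as true, its negation adds nothing. The other
connectives derive from this one. -/
theorem exists_not {ι : Type*} [Countable ι] {P : ι → (ℕ → HC.{u}) → Prop}
    (hP : ∀ k, Coded (P k)) : Coded fun f => ∃ k, ¬ P k f := by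
  choose c hc using hP
  refine ⟨ofCountable (insert empty (Set.range c)) ((Set.countable_range _).insert _),
    fun f S T hf hE hcT => ?_⟩
  rw [hE.compound _ hcT (by simp)]
  constructor
  · rintro ⟨s, hs, hsS⟩
    rw [mem_ofCountable] at hs
    rcases hs with rfl | ⟨k, rfl⟩
    · exact absurd hE.empty_mem hsS
    · exact ⟨k, fun h => hsS ((hc k f S T hf hE (hE.trans _ hcT _ (by simp))).2 h)⟩
  · rintro ⟨k, hk⟩
    exact ⟨c k, by simp,
      fun h => hk ((hc k f S T hf hE (hE.trans _ hcT _ (by simp))).1 h)⟩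

theorem not {P : (ℕ → HC.{u}) → Prop} (hP : Coded P) : Coded fun f => ¬ P f :=
  (exists_not (ι := Unit) fun _ => hP).congr fun f _ => by simp

theorem exists' {ι : Type*} [Countable ι] {P : ι → (ℕ → HC.{u}) → Prop}
    (hP : ∀ k, Coded (P k)) : Coded fun f => ∃ k, P k f :=
  (exists_not fun k => (hP k).not).congr fun f _ => by simp

theorem forall' {ι : Type*} [Countable ι] {P : ι → (ℕ → HC.{u}) → Prop}
    (hP : ∀ k, Coded (P k)) : Coded fun f => ∀ k, P k f :=
  (exists_not hP).not.congr fun f _ => by simp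

theorem and {P Q : (ℕ → HC.{u}) → Prop} (hP : Coded P) (hQ : Coded Q) :
    Coded fun f => P f ∧ Q f :=
  (forall' (ι := Bool) (P := fun b => bif b then P else Q) (by rintro (_ | _) <;> assumption)).congr
    fun f _ => by simp [and_comm]

theorem imp {P Q : (ℕ → HC.{u}) → Prop} (hP : Coded P) (hQ : Coded Q) :
    Coded fun f => P f → Q f :=
  (hP.and hQ.not).not.congr fun f _ => by tauto

theorem iff {P Q : (ℕ → HC.{u}) → Prop} (hP : Coded P) (hQ : Coded Q) :
    Coded fun f => P f ↔ Q f :=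
  ((hP.imp hQ).and (hQ.imp hP)).congr fun f _ => by tauto

theorem const (p : Prop) : Coded fun _ : ℕ → HC.{u} => p := by
  by_cases h : p
  · exact (forall' (ι := Empty) (P := fun _ _ => True) nofun).congr fun _ _ => by simp [h]
  · exact (exists_not (ι := Empty) (P := fun _ _ => True) nofun).congr fun _ _ => by simp [h]

/-- By extensionality: every member of `f i` or `f j` is some `f k`, as the range is transitive, so
a countable conjunction over `k` suffices. -/
theorem eq (i j : ℕ) : Coded fun f : ℕ → HC.{u} => f i = f j := by
  refine (forall' fun k : ℕ => (atom k i).iff (atom k j)).congr fun f hf => ?_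
  constructor
  · intro h
    apply ext
    intro z
    constructor
    · intro hz
      obtain ⟨k, rfl⟩ := hf i z hz
      exact (h k).1 hz
    · intro hz
      obtain ⟨k, rfl⟩ := hf j z hz
      exact (h k).2 hz
  · intro h k
    rw [h]

/-- By ∈-induction on `p`, which has only countably many members to be matched with those of `f i`.
Parameters thereby enter coded properties. -/
theorem eq_const (p : HC.{u}) : ∀ i : ℕ, Coded fun f : ℕ → HC.{u} => f i = p := by
  induction p using wellFounded_mem.induction with
  | _ p ih =>
  intro i
  have := (countable_members p).to_subtype
  have h1 : Coded fun f : ℕ → HC.{u} =>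
      ∀ q : {q | q ∈ p}, ∃ j : ℕ, f j ∈ f i ∧ f j = q.1 :=
    forall' fun q => exists' fun j => (atom j i).and (ih q.1 q.2 j)
  have h2 : Coded fun f : ℕ → HC.{u} =>
      ∀ j : ℕ, f j ∈ f i → ∃ q : {q | q ∈ p}, f j = q.1 :=
    forall' fun j => (atom j i).imp (exists' fun q => ih q.1 q.2 j)
  refine (h1.and h2).congr fun f hf => ?_
  constructor
  · rintro ⟨h1, h2⟩
    apply ext
    intro z
    constructor
    · intro hz
      obtain ⟨j, rfl⟩ := hf i z hz
      obtain ⟨q, hq⟩ := h2 j hz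
      rw [hq]
      exact q.2
    · intro hz
      obtain ⟨j, hj, hjz⟩ := h1 ⟨z, hz⟩
      change f j = z at hjz
      exact hjz ▸ hj
  · rintro rfl
    refine ⟨?_, ?_⟩
    · rintro ⟨q, hq⟩
      obtain ⟨j, rfl⟩ := hf i q hq
      exact ⟨j, hq, rfl⟩
    · intro j hj
      exact ⟨⟨f j, hj⟩, rfl⟩

/-- The terms of the language of set theory are its variables. -/
theorem term_eq_var {β : Type} (t : memLang.Term β) : ∃ b, t = Term.var b := by
  cases t with
  | var b => exact ⟨b, rfl⟩
  | func g _ => exact Empty.elim g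

theorem sum_elim_val {α : Type} {n : ℕ} (f : ℕ → HC.{u}) (v : α → ℕ) (w : Fin n → ℕ)
    (b : α ⊕ Fin n) :
    Sum.elim (fun a => (f (v a)).1) (fun k => (f (w k)).1) b = (f (Sum.elim v w b)).1 := by
  cases b <;> rfl

theorem snoc_val {n : ℕ} (f : ℕ → HC.{u}) (w : Fin n → ℕ) (j : ℕ) :
    (Fin.snoc (fun k => (f (w k)).1) (f j).1 : Fin (n + 1) → ZFSet.{u}) =
      fun k => (f ((Fin.snoc w j : Fin (n + 1) → ℕ) k)).1 := by
  funext k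
  refine Fin.lastCases ?_ (fun k => ?_) k <;> simp

theorem realize_newMem {α : Type} {n : ℕ} (b : α ⊕ Fin n) (v : α → ZFSet.{u})
    (w : Fin n → ZFSet.{u}) (x : ZFSet.{u}) :
    (newMem b).Realize v (Fin.snoc w x) ↔ x ∈ Sum.elim v w b := by
  change Term.realize _ (Term.var (Sum.inr (Fin.last n))) ∈
    Term.realize _ (Term.var (Sum.map id Fin.castSucc b)) ↔ _
  cases b <;> simp

/-- Variables stand for indices. A quantifier bounded by a term of the enumeration ranges over terms
of the enumeration, hence becomes a countable conjunction or disjunction over indices. -/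
theorem realize_bounded {α : Type} {n : ℕ} {ψ : memLang.BoundedFormula α n} (hψ : IsBounded ψ) :
    ∀ (v : α → ℕ) (w : Fin n → ℕ), Coded fun f : ℕ → HC.{u} =>
      ψ.Realize (fun a => (f (v a)).1) (fun k => (f (w k)).1) := by
  induction hψ with
  | falsum => exact fun v w => const False
  | equal s t =>
    intro v w
    obtain ⟨a, rfl⟩ := term_eq_var s
    obtain ⟨b, rfl⟩ := term_eq_var t
    refine (eq (Sum.elim v w a) (Sum.elim v w b)).congr fun f _ => ?_
    simp only [BoundedFormula.Realize, Term.realize_var, sum_elim_val]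
    exact Subtype.ext_iff
  | rel R ts =>
    intro v w
    cases R
    obtain ⟨a, ha⟩ := term_eq_var (ts 0)
    obtain ⟨b, hb⟩ := term_eq_var (ts 1)
    refine (atom (Sum.elim v w a) (Sum.elim v w b)).congr fun f _ => ?_
    simp only [BoundedFormula.Realize]
    change _ ↔ Term.realize _ (ts 0) ∈ Term.realize _ (ts 1)
    rw [ha, hb, Term.realize_var, Term.realize_var, sum_elim_val, sum_elim_val]
    rfl
  | imp _ _ ih1 ih2 => exact fun v w => (ih1 v w).imp (ih2 v w)
  | ballMem b _ ih =>
    intro v w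
    refine (forall' fun j : ℕ => (atom j (Sum.elim v w b)).imp (ih v (Fin.snoc w j))).congr
      fun f hf => ?_
    simp only [BoundedFormula.realize_all, BoundedFormula.realize_imp, realize_newMem,
      sum_elim_val]
    constructor
    · intro h x hx
      obtain ⟨y, rfl⟩ := exists_of_mem hx
      obtain ⟨j, rfl⟩ := hf _ y hx
      rw [snoc_val]
      exact h j hx
    · intro h j hj
      rw [← snoc_val]
      exact h _ hj
  | bexMem b _ ih =>
    intro v w
    refine (exists' fun j : ℕ => (atom j (Sum.elim v w b)).and (ih v (Fin.snoc w j))).congr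
      fun f hf => ?_
    simp only [BoundedFormula.realize_ex, BoundedFormula.realize_inf, realize_newMem,
      sum_elim_val]
    constructor
    · rintro ⟨j, hj, h⟩
      refine ⟨(f j).1, hj, ?_⟩
      rw [snoc_val]
      exact h
    · rintro ⟨x, hx, h⟩
      obtain ⟨y, rfl⟩ := exists_of_mem hx
      obtain ⟨j, rfl⟩ := hf _ y hx
      rw [snoc_val] at h
      exact ⟨j, hx, h⟩

theorem relMap {n : ℕ} (R : starLang.Relations n) (v : Fin n → ℕ) :
    Coded fun f : ℕ → HC.{u} => Structure.RelMap R (f ∘ v) := by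
  obtain ⟨φ, ψ, hψ, h⟩ := R
  refine (realize_bounded hψ v Fin.elim0).congr fun f _ => ?_
  change _ ↔ φ.Realize fun i => (f (v i)).1
  have : Nonempty ZFSet.{u} := ⟨∅⟩
  rw [h.realize_iff, Formula.Realize, iff_eq_eq]
  congr 1
  exact Subsingleton.elim _ _

end Coded

/-! ### The universal relation and the diagonal argument. -/

/-- The projection to the first term of the enumerations with the property `P`. -/
def Proj (P : (ℕ → HC.{u}) → Prop) (x : HC.{u}) : Prop := ∃ f, TransRange f ∧ f 0 = x ∧ P f

/-- The universal relation for projections of coded properties. -/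
def Univ (c x : HC.{u}) : Prop :=
  ∃ f S T, TransRange f ∧ Eval f S T ∧ c ∈ T ∧ c ∈ S ∧ f 0 = x

/-- `Codes` fixes the truth value of `c` in every evaluation whose `T` contains `c`, and
`exists_eval` supplies one; so quantifying existentially over evaluations is harmless. -/
theorem Codes.univ_iff {c : HC.{u}} {P : (ℕ → HC.{u}) → Prop} (h : Codes c P) (x : HC.{u}) :
    Univ c x ↔ Proj P x := by
  constructor
  · rintro ⟨f, S, T, hf, hE, hT, hS, hx⟩
    exact ⟨f, hf, hx, (h f S T hf hE hT).1 hS⟩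
  · rintro ⟨f, hf, hx, hP⟩
    obtain ⟨S, T, hE, hT⟩ := exists_eval f c
    exact ⟨f, S, T, hf, hE, hT, (h f S T hf hE hT).2 hP, hx⟩

/-- Russell's argument: the point is the code `c` of `P` itself, for which `Univ c c` and `Proj P c`
are equivalent. -/
theorem Coded.exists_not_univ_not_proj {P : (ℕ → HC.{u}) → Prop} (hP : Coded P)
    (h : ∀ x, Proj P x → ¬ Univ x x) : ∃ x, ¬ Univ x x ∧ ¬ Proj P x := by
  obtain ⟨c, hc⟩ := hP
  have h1 : ¬ Proj P c := fun hp => h c hp ((hc.univ_iff c).2 hp)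
  exact ⟨c, fun hu => h1 ((hc.univ_iff c).1 hu), h1⟩

/-- Finitely many hereditarily countable sets occur at prescribed places of an enumeration of a
transitive set. -/
theorem exists_transRange {M : Type v} (s : Finset M) {e : M → ℕ} (he : Set.InjOn e s)
    (heven : ∀ m ∈ s, Even (e m)) (h : M → HC.{u}) :
    ∃ f, TransRange f ∧ ∀ m ∈ s, f (e m) = h m := by
  classical
  obtain ⟨T, hT, hT'⟩ := exists_transitive (insert empty (h '' s))
    ((s.countable_toSet.image h).insert _)
  obtain ⟨g, hg⟩ := (countable_members T).exists_eq_range ⟨empty, hT _ (by simp)⟩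
  have hgT : ∀ {z}, z ∈ T ↔ ∃ k, g k = z := by
    intro z
    have : z ∈ {b | b ∈ T} ↔ z ∈ Set.range g := by rw [hg]
    exact this
  -- The prescribed places are even, so the odd ones are free to enumerate all of `T`.
  let f : ℕ → HC.{u} := fun k => if hk : ∃ m ∈ s, e m = k then h hk.choose else g (k / 2)
  have hfe : ∀ m ∈ s, f (e m) = h m := by
    intro m hm
    have hk : ∃ m' ∈ s, e m' = e m := ⟨m, hm, rfl⟩
    have : f (e m) = h hk.choose := dif_pos hk
    rw [this, he hk.choose_spec.1 hm hk.choose_spec.2]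
  have hodd : ∀ k, f (2 * k + 1) = g k := by
    intro k
    have hk : ¬ ∃ m ∈ s, e m = 2 * k + 1 := by
      rintro ⟨m, hm, h'⟩
      have := heven m hm
      rw [h'] at this
      exact absurd this (by simp [parity_simps])
    have : f (2 * k + 1) = g ((2 * k + 1) / 2) := dif_neg hk
    rw [this]
    congr 1
    omega
  refine ⟨f, fun i z hz => ?_, hfe⟩
  have hi : f i ∈ T := by
    by_cases hk : ∃ m ∈ s, e m = i
    · obtain ⟨m, hm, rfl⟩ := hk
      rw [hfe m hm]
      exact hT _ (Set.mem_insert_of_mem _ ⟨m, hm, rfl⟩)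
    · have : f i = g (i / 2) := dif_neg hk
      rw [this]
      exact hgT.2 ⟨_, rfl⟩
  obtain ⟨k, rfl⟩ := hgT.1 (hT' _ hi z hz)
  exact ⟨2 * k + 1, hodd k⟩

/-! ### First-order definability of the universal relation. -/

/-- `P` is first-order definable with parameters over the hereditarily countable sets. -/
def Dfn (P : (ℕ → HC.{u}) → Prop) : Prop :=
  ∃ φ : (starLang[[HC.{u}]]).Formula ℕ, ∀ v : ℕ → HC.{u}, φ.Realize v ↔ P v

/-- `t` is given by a term, that is, it is a variable or a parameter. -/
def DfnTerm (t : (ℕ → HC.{u}) → HC.{u}) : Prop :=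
  ∃ τ : (starLang[[HC.{u}]]).Term ℕ, ∀ v : ℕ → HC.{u}, τ.realize v = t v

theorem DfnTerm.var (i : ℕ) : DfnTerm fun v : ℕ → HC.{u} => v i := ⟨Term.var i, fun _ => rfl⟩

theorem DfnTerm.const (c : HC.{u}) : DfnTerm fun _ : ℕ → HC.{u} => c :=
  ⟨(starLang.con c).term, fun _ => Term.realize_constants⟩

theorem DfnTerm.shift {t : (ℕ → HC.{u}) → HC.{u}} (ht : DfnTerm t) :
    DfnTerm fun w => t fun k => w (k + 1) := by
  obtain ⟨τ, hτ⟩ := ht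
  exact ⟨τ.relabel Nat.succ, fun w => by rw [Term.realize_relabel, hτ]; rfl⟩

/-- The symbol of `starLang` for membership. -/
def memStar : starLang.Relations 2 :=
  ⟨memSym.formula₂ (Term.var 0) (Term.var 1), _, IsBounded.rel _ _, Theory.Iff.refl _⟩

/-- The symbol of `starLang` for equality. -/
def eqStar : starLang.Relations 2 :=
  ⟨Term.equal (Term.var 0) (Term.var 1), _, IsBounded.equal _ _, Theory.Iff.refl _⟩

theorem relMap_memStar (x : Fin 2 → HC.{u}) : Structure.RelMap memStar x ↔ x 0 ∈ x 1 := Iff.rfl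

theorem relMap_eqStar (x : Fin 2 → HC.{u}) : Structure.RelMap eqStar x ↔ x 0 = x 1 :=
  Subtype.ext_iff.symm

namespace Dfn

theorem congr {P Q : (ℕ → HC.{u}) → Prop} (hP : Dfn P) (h : ∀ v, P v ↔ Q v) : Dfn Q := by
  obtain ⟨φ, hφ⟩ := hP
  exact ⟨φ, fun v => (hφ v).trans (h v)⟩

theorem mem {t s : (ℕ → HC.{u}) → HC.{u}} (ht : DfnTerm t) (hs : DfnTerm s) :
    Dfn fun v => t v ∈ s v := by
  obtain ⟨τ, hτ⟩ := ht
  obtain ⟨σ, hσ⟩ := hs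
  refine ⟨Relations.formula₂ ((starLang.lhomWithConstants HC.{u}).onRelation memStar) τ σ,
    fun v => ?_⟩
  refine Formula.realize_rel₂.trans ?_
  rw [hτ, hσ]
  exact relMap_memStar _

theorem eq {t s : (ℕ → HC.{u}) → HC.{u}} (ht : DfnTerm t) (hs : DfnTerm s) :
    Dfn fun v => t v = s v := by
  obtain ⟨τ, hτ⟩ := ht
  obtain ⟨σ, hσ⟩ := hs
  exact ⟨τ.equal σ, fun v => by rw [Formula.realize_equal, hτ, hσ]⟩

theorem not {P : (ℕ → HC.{u}) → Prop} (hP : Dfn P) : Dfn fun v => ¬ P v := by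
  obtain ⟨φ, hφ⟩ := hP
  exact ⟨φ.not, fun v => by rw [Formula.realize_not, hφ]⟩

theorem and {P Q : (ℕ → HC.{u}) → Prop} (hP : Dfn P) (hQ : Dfn Q) : Dfn fun v => P v ∧ Q v := by
  obtain ⟨φ, hφ⟩ := hP
  obtain ⟨ψ, hψ⟩ := hQ
  exact ⟨φ ⊓ ψ, fun v => by rw [Formula.realize_inf, hφ, hψ]⟩

theorem or {P Q : (ℕ → HC.{u}) → Prop} (hP : Dfn P) (hQ : Dfn Q) : Dfn fun v => P v ∨ Q v :=
  (hP.not.and hQ.not).not.congr fun v => by tauto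

theorem imp {P Q : (ℕ → HC.{u}) → Prop} (hP : Dfn P) (hQ : Dfn Q) : Dfn fun v => P v → Q v :=
  (hP.and hQ.not).not.congr fun v => by tauto

theorem iff {P Q : (ℕ → HC.{u}) → Prop} (hP : Dfn P) (hQ : Dfn Q) : Dfn fun v => (P v ↔ Q v) :=
  ((hP.imp hQ).and (hQ.imp hP)).congr fun v => by tauto

theorem ex {P : (ℕ → HC.{u}) → HC.{u} → Prop} (hP : Dfn fun w => P (fun k => w (k + 1)) (w 0)) :
    Dfn fun v => ∃ a, P v a := by
  obtain ⟨φ, hφ⟩ := hP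
  -- Variable `0` becomes the quantified one, and `k + 1` becomes the free variable `k`.
  let g : ℕ → ℕ ⊕ Fin 1 := fun k => Nat.casesOn k (Sum.inr 0) Sum.inl
  refine ⟨(BoundedFormula.relabel (n := 1) (k := 0) g φ).ex, fun v => ?_⟩
  rw [Formula.Realize, BoundedFormula.realize_ex]
  refine exists_congr fun a => ?_
  rw [BoundedFormula.realize_relabel]
  have h := hφ fun k => Nat.casesOn k a v
  refine Iff.trans ?_ h
  rw [Formula.Realize, iff_eq_eq]
  congr 1
  · funext k
    cases k with
    | zero => exact Fin.snoc_last (α := fun _ => HC.{u}) (n := 0) a default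
    | succ k => rfl
  · exact Subsingleton.elim _ _

theorem all {P : (ℕ → HC.{u}) → HC.{u} → Prop} (hP : Dfn fun w => P (fun k => w (k + 1)) (w 0)) :
    Dfn fun v => ∀ a, P v a :=
  (ex (P := fun v a => ¬ P v a) hP.not).not.congr fun v => by simp

theorem eq_upair {s a b : (ℕ → HC.{u}) → HC.{u}} (hs : DfnTerm s) (ha : DfnTerm a)
    (hb : DfnTerm b) : Dfn fun v => s v = upair (a v) (b v) := by
  refine congr (P := fun v => ∀ z, z ∈ s v ↔ (z = a v ∨ z = b v)) (all ?_)
    fun v => eq_upair_iff.symm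
  exact (mem (.var 0) hs.shift).iff ((eq (.var 0) ha.shift).or (eq (.var 0) hb.shift))

theorem pair_mem {a b g : (ℕ → HC.{u}) → HC.{u}} (ha : DfnTerm a) (hb : DfnTerm b)
    (hg : DfnTerm g) : Dfn fun v => pair (a v) (b v) ∈ g v := by
  refine congr (P := fun v => ∃ s p q, p = upair (a v) (a v) ∧ q = upair (a v) (b v) ∧
    s = upair p q ∧ s ∈ g v) (ex <| ex <| ex ?_) fun v => by simp [pair]
  exact (eq_upair (.var 1) ha.shift.shift.shift ha.shift.shift.shift).and
    ((eq_upair (.var 0) ha.shift.shift.shift hb.shift.shift.shift).and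
    ((eq_upair (.var 2) (.var 1) (.var 0)).and (mem (.var 2) hg.shift.shift.shift)))

end Dfn

/-- `G` is the graph of an enumeration that witnesses `Univ c x` together with `S` and `T`. -/
def Witness (c x G S T : HC.{u}) : Prop :=
  (∀ i, i ∈ names → ∃ y, pair i y ∈ G) ∧
  (∀ i y z, pair i y ∈ G → pair i z ∈ G → y = z) ∧
  (∀ i y z, pair i y ∈ G → z ∈ y → ∃ j, j ∈ names ∧ pair j z ∈ G) ∧
  (∀ t s, t ∈ T → s ∈ t → s ∈ T) ∧
  empty ∈ S ∧
  (∀ t, t ∈ T → empty ∈ t → (t ∈ S ↔ ∃ s, s ∈ t ∧ ¬ s ∈ S)) ∧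
  (∀ i j y z, i ∈ names → j ∈ names → pair i y ∈ G → pair j z ∈ G →
    (pair i j ∈ S ↔ y ∈ z)) ∧
  c ∈ T ∧ c ∈ S ∧ pair empty x ∈ G

/-- An enumeration is replaced by its graph on `names`, which is a hereditarily countable set; the
quantifier over functions thus becomes first-order. -/
theorem univ_iff_witness (c x : HC.{u}) : Univ c x ↔ ∃ G S T, Witness c x G S T := by
  constructor
  · rintro ⟨f, S, T, hf, hE, hT, hS, hx⟩
    let G : HC.{u} := ofCountable (Set.range fun n => pair (name n) (f n)) (Set.countable_range _)
    have hG : ∀ n z, pair (name n) z ∈ G ↔ f n = z := by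
      intro n z
      simp [G, pair_inj, name_injective.eq_iff]
    have hG' : ∀ i z, pair i z ∈ G → ∃ n, name n = i ∧ f n = z := by
      intro i z h
      simpa [G, pair_inj] using h
    refine ⟨G, S, T, ?_, ?_, ?_, fun t s ht hs => hE.trans t ht s hs, hE.empty_mem,
      hE.compound, ?_, hT, hS, (hG 0 x).2 hx⟩
    · intro i hi
      obtain ⟨n, rfl⟩ := mem_names.1 hi
      exact ⟨f n, (hG _ _).2 rfl⟩
    · intro i y z hy hz
      obtain ⟨n, rfl, rfl⟩ := hG' i y hy
      exact (hG _ _).1 hz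
    · intro i y z hy hz
      obtain ⟨n, rfl, rfl⟩ := hG' i y hy
      obtain ⟨m, rfl⟩ := hf n z hz
      exact ⟨name m, mem_names.2 ⟨m, rfl⟩, (hG _ _).2 rfl⟩
    · intro i j y z _ _ hy hz
      obtain ⟨n, rfl, rfl⟩ := hG' i y hy
      obtain ⟨m, rfl, rfl⟩ := hG' j z hz
      exact hE.atom n m
  · rintro ⟨G, S, T, h1, h2, h3, h4, h5, h6, h7, h8, h9, h10⟩
    choose f hf using fun n => h1 (name n) (mem_names.2 ⟨n, rfl⟩)
    refine ⟨f, S, T, ?_, ⟨fun t ht s hs => h4 t s ht hs, h5, h6, ?_⟩, h8, h9, ?_⟩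
    · intro n z hz
      obtain ⟨j, hj, hjz⟩ := h3 _ _ _ (hf n) hz
      obtain ⟨m, rfl⟩ := mem_names.1 hj
      exact ⟨m, h2 _ _ _ (hf m) hjz⟩
    · intro i j
      exact h7 _ _ _ _ (mem_names.2 ⟨i, rfl⟩) (mem_names.2 ⟨j, rfl⟩) (hf i) (hf j)
    · exact h2 _ _ _ (hf 0) h10

theorem dfn_univ : Dfn fun v : ℕ → HC.{u} => Univ (v 0) (v 0) := by
  refine Dfn.congr (P := fun v => ∃ G S T, Witness (v 0) (v 0) G S T) ?_
    fun v => (univ_iff_witness _ _).symm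
  unfold Witness
  repeat' first
    | exact DfnTerm.var _
    | exact DfnTerm.const _
    | refine Dfn.and ?_ ?_
    | refine Dfn.ex ?_
    | refine Dfn.iff ?_ ?_
    | refine Dfn.not ?_
    | refine Dfn.pair_mem ?_ ?_ ?_
    | refine Dfn.mem ?_ ?_
    | refine Dfn.eq ?_ ?_
    | refine Dfn.imp ?_ ?_
    | refine Dfn.all ?_

/-! ### Ultrapowers and Łoś's theorem. -/

open Filter

instance : Nonempty HC.{u} := ⟨empty⟩

/-- The ultrapower of the hereditarily countable sets. -/
def Pow {I : Type v} (U : Ultrafilter I) : Type (max v (u + 1)) :=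
  (U : Filter I).Product fun _ => HC.{u}

namespace Pow

variable {I : Type v} {U : Ultrafilter I}

instance starStructure : starLang.Structure (Pow.{u} U) := Ultraproduct.structure

instance structureWithConstants : (starLang[[HC.{u}]]).Structure (Pow.{u} U) :=
  Ultraproduct.structure

/-- The class of a family. -/
def mk (U : Ultrafilter I) (x : I → HC.{u}) : Pow.{u} U :=
  (x : (U : Filter I).Product fun _ => HC.{u})

instance : Nonempty (Pow.{u} U) := ⟨mk U fun _ => empty⟩

theorem mk_surjective (m : Pow.{u} U) : ∃ x, mk U x = m := Quotient.exists_rep m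

theorem mk_eq_mk {x y : I → HC.{u}} : mk U x = mk U y ↔ ∀ᶠ i in U, x i = y i :=
  Quotient.eq (r := (U : Filter I).productSetoid fun _ => HC.{u})

theorem relMap_mk {n : ℕ} (R : starLang.Relations n) (x : Fin n → I → HC.{u}) :
    (Structure.RelMap R fun k => mk U (x k)) ↔ ∀ᶠ i in U, Structure.RelMap R fun k => x k i :=
  relMap_quotient_mk' ((U : Filter I).productSetoid fun _ => HC.{u}) R x

theorem realize_mk {β : Type*} (φ : (starLang[[HC.{u}]]).Formula β) (x : β → I → HC.{u}) :
    (φ.Realize fun k => mk U (x k)) ↔ ∀ᶠ i in U, φ.Realize fun k => x k i :=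
  Ultraproduct.realize_formula_cast (M := fun _ : I => HC.{u}) φ x

theorem models (U : Ultrafilter I) : Pow.{u} U ⊨ theoryHC.{u} :=
  (Theory.model_iff _).2 fun φ hφ =>
    (Ultraproduct.sentence_realize (M := fun _ : I => HC.{u}) φ).2
      (Eventually.of_forall fun _ => hφ)

end Pow

theorem exists_funMap_eq {n : ℕ} (g : (starLang[[HC.{u}]]).Functions n) :
    ∃ p : HC.{u}, ∀ x : Fin n → HC.{u}, Structure.funMap g x = p := by
  rcases g with g | g
  · exact Empty.elim g
  · match n, g with
    | 0, g => exact ⟨g, fun _ => rfl⟩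
    | n + 1, g => exact isEmptyElim g

theorem Pow.funMap_eq {I : Type v} {U : Ultrafilter I} {n : ℕ}
    {g : (starLang[[HC.{u}]]).Functions n} {p : HC.{u}}
    (hp : ∀ x : Fin n → HC.{u}, Structure.funMap g x = p) (x : Fin n → Pow.{u} U) :
    Structure.funMap g x = mk U fun _ => p := by
  choose y hy using fun k => mk_surjective (x k)
  obtain rfl : (fun k => mk U (y k)) = x := funext hy
  refine (Ultraproduct.funMap_cast (M := fun _ : I => HC.{u}) g y).trans ?_
  simp only [hp]
  rfl

/-! ### Finite approximations, the generic point and the embedding. -/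

/-- A point of an ultrapower that avoids the projections of coded properties contained in the
complement of the diagonal can be moved into the diagonal, in a way that preserves finitely many
atomic facts. -/
theorem exists_finite_approx {I : Type v} {U : Ultrafilter I} (a : I → HC.{u})
    (ha : ∀ P : (ℕ → HC.{u}) → Prop, Coded P → (∀ x, Proj P x → ¬ Univ x x) →
      ∀ᶠ i in U, ¬ Proj P (a i))
    (F : Finset (Σ n, starLang.Relations n × (Fin n → Pow.{u} U)))
    (G : Finset HC.{u}) :
    ∃ h : Pow.{u} U → HC.{u},
      (∀ q ∈ F, Structure.RelMap q.2.1 (h ∘ q.2.2) ↔ Structure.RelMap q.2.1 q.2.2) ∧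
      (∀ p ∈ G, h (Pow.mk U fun _ => p) = p) ∧ Univ (h (Pow.mk U a)) (h (Pow.mk U a)) := by
  classical
  by_contra hcon
  let A : Pow.{u} U := Pow.mk U a
  let con : HC.{u} → Pow.{u} U := fun p => Pow.mk U fun _ => p
  let s : Finset (Pow.{u} U) :=
    insert A ((F.biUnion fun q => Finset.univ.image q.2.2) ∪ G.image con)
  have hsA : A ∈ s := Finset.mem_insert_self _ _
  have hsF : ∀ q ∈ F, ∀ k, q.2.2 k ∈ s := fun q hq k =>
    Finset.mem_insert_of_mem (Finset.mem_union_left _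
      (Finset.mem_biUnion.2 ⟨q, hq, Finset.mem_image_of_mem _ (Finset.mem_univ k)⟩))
  have hsG : ∀ p ∈ G, con p ∈ s := fun p hp =>
    Finset.mem_insert_of_mem (Finset.mem_union_right _ (Finset.mem_image_of_mem _ hp))
  obtain ⟨idx, hidx⟩ := Set.countable_iff_exists_injOn.1 s.countable_toSet
  -- `A` gets place `0`, the one that `Proj` reads off; the other points get positive even places.
  let e : Pow.{u} U → ℕ :=
    fun m => if m = A then 0 else 2 * idx m + 2
  have heA : e A = 0 := if_pos rfl
  have he : Set.InjOn e s := by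
    intro m hm m' hm' h
    by_cases h1 : m = A <;> by_cases h2 : m' = A <;> simp only [e, h1, h2, if_true, if_false] at h ⊢
    · omega
    · omega
    · exact hidx hm hm' (by omega)
  have heven : ∀ m ∈ s, Even (e m) := by
    intro m _
    by_cases h1 : m = A <;> simp [e, h1, parity_simps]
  -- `P` says that `f` satisfies the given finite part of the atomic diagram. The truth values in
  -- the ultrapower are fixed propositions, hence coded by `Coded.const`.
  let P : (ℕ → HC.{u}) → Prop := fun f =>
    (∀ q : F, Structure.RelMap q.1.2.1 (f ∘ (e ∘ q.1.2.2)) ↔ Structure.RelMap q.1.2.1 q.1.2.2) ∧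
      ∀ p : G, f (e (con p.1)) = p.1
  have hP : Coded P :=
    (Coded.forall' fun q : F => (Coded.relMap q.1.2.1 (e ∘ q.1.2.2)).iff (Coded.const _)).and
      (Coded.forall' fun p : G => Coded.eq_const p.1 _)
  -- An enumeration with `P` whose first term is in the diagonal would be the approximation denied
  -- by `hcon`; so `Proj P` misses the diagonal and `ha` applies.
  have hev := ha P hP fun x ⟨f, _, hx, hf1, hf2⟩ hu => hcon
    ⟨f ∘ e, fun q hq => hf1 ⟨q, hq⟩, fun p hp => hf2 ⟨p, hp⟩, by
      have : (f ∘ e) A = x := by rw [Function.comp_apply, heA, hx]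
      change Univ ((f ∘ e) A) ((f ∘ e) A)
      rwa [this]⟩
  obtain ⟨r, hr⟩ : ∃ r : Pow.{u} U → I → HC.{u},
      ∀ m, Pow.mk U (r m) = m :=
    Classical.skolem.1 Pow.mk_surjective
  have hrel : ∀ m (x : I → HC.{u}), Pow.mk U x = m → ∀ᶠ i in U, r m i = x i :=
    fun m x hx => Pow.mk_eq_mk.1 ((hr m).trans hx.symm)
  have h1 : ∀ᶠ i in U, ∀ q ∈ F, (Structure.RelMap q.2.1 (fun k => r (q.2.2 k) i) ↔
      Structure.RelMap q.2.1 q.2.2) := by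
    rw [eventually_all_finset]
    intro q _
    have h := Pow.relMap_mk (U := U) q.2.1 fun k => r (q.2.2 k)
    simp only [hr] at h
    by_cases hq : Structure.RelMap q.2.1 q.2.2
    · filter_upwards [h.1 hq] with i hi
      exact iff_of_true hi hq
    · filter_upwards [Ultrafilter.eventually_not.2 fun h' => hq (h.2 h')] with i hi
      exact iff_of_false hi hq
  have h2 : ∀ᶠ i in U, ∀ p ∈ G, r (con p) i = p := by
    rw [eventually_all_finset]
    exact fun p _ => hrel _ _ rfl
  obtain ⟨i, hi, hi1, hi2, hiA⟩ := (hev.and (h1.and (h2.and (hrel A a rfl)))).exists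
  -- At a suitable index `i` the representatives themselves show `Proj P (a i)`, a contradiction.
  obtain ⟨f, hf, hfe⟩ := exists_transRange s he heven fun m => r m i
  refine hi ⟨f, hf, ?_, ?_, ?_⟩
  · rw [← heA, hfe A hsA, hiA]
  · rintro ⟨q, hq⟩
    rw [← hi1 q hq, iff_eq_eq]
    congr 1
    funext k
    exact hfe _ (hsF q hq k)
  · rintro ⟨p, hp⟩
    rw [hfe _ (hsG p hp), hi2 p hp]

/-- There is an ultrapower with an element outside the diagonal that avoids every projection of a
coded property contained in the complement of the diagonal. -/
theorem exists_generic : ∃ (I : Type (u + 1)) (U : Ultrafilter I) (a : I → HC.{u}),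
    (∀ i, ¬ Univ (a i) (a i)) ∧
    ∀ P : (ℕ → HC.{u}) → Prop, Coded P → (∀ x, Proj P x → ¬ Univ x x) →
      ∀ᶠ i in U, ¬ Proj P (a i) := by
  classical
  let Q := {P : (ℕ → HC.{u}) → Prop // Coded P ∧ ∀ x, Proj P x → ¬ Univ x x}
  have h : ∀ F : Finset Q, ∃ x : HC.{u}, ¬ Univ x x ∧ ∀ P ∈ F, ¬ Proj P.1 x := by
    intro F
    -- The union of finitely many projections disjoint from the diagonal is again one, so the
    -- diagonal argument yields a point outside all of them.
    have hP : Coded fun f => ∃ P : F, P.1.1 f := Coded.exists' fun P => P.1.2.1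
    obtain ⟨x, hx, hx'⟩ := hP.exists_not_univ_not_proj
      fun x ⟨f, hf, hfx, P, hPf⟩ => P.1.2.2 x ⟨f, hf, hfx, hPf⟩
    exact ⟨x, hx, fun P hP ⟨f, hf, hfx, hPf⟩ => hx' ⟨f, hf, hfx, ⟨P, hP⟩, hPf⟩⟩
  choose a ha ha' using h
  refine ⟨Finset Q, Ultrafilter.of atTop, a, ha, fun P hP hPu => ?_⟩
  refine Ultrafilter.of_le _ ?_
  filter_upwards [eventually_ge_atTop {(⟨P, hP, hPu⟩ : Q)}] with F hF
  exact ha' F ⟨P, hP, hPu⟩ (hF (Finset.mem_singleton_self _))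

/-- The embedding of ultrapowers given by approximations that respect the atomic facts. -/
theorem exists_embedding {I : Type v} {U : Ultrafilter I} (a : I → HC.{u})
    (ha : ∀ P : (ℕ → HC.{u}) → Prop, Coded P → (∀ x, Proj P x → ¬ Univ x x) →
      ∀ᶠ i in U, ¬ Proj P (a i)) :
    ∃ (J : Type (max v (u + 1))) (W : Ultrafilter J)
      (g : Pow.{u} U ↪[starLang[[HC.{u}]]] Pow.{u} W) (b : J → HC.{u}),
      g (Pow.mk U a) = Pow.mk W b ∧ ∀ j, Univ (b j) (b j) := by
  classical
  choose h hF hG hU using exists_finite_approx a ha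
  let K := Σ n, starLang.Relations n × (Fin n → Pow.{u} U)
  let J := Finset K × Finset HC.{u}
  -- As `W` refines `atTop`, each single atomic fact or parameter is respected at `W`-almost all
  -- `j`.
  let W : Ultrafilter J := Ultrafilter.of atTop
  let k : Pow.{u} U → J → HC.{u} := fun m j => h j.1 j.2 m
  have hrel : ∀ {n : ℕ} (R : starLang.Relations n)
      (x : Fin n → Pow.{u} U),
      ∀ᶠ j in W, (Structure.RelMap R (fun i => k (x i) j) ↔ Structure.RelMap R x) := by
    intro n R x
    refine Ultrafilter.of_le _ ?_
    filter_upwards [eventually_ge_atTop (({⟨n, R, x⟩}, ∅) : J)] with j hj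
    exact hF j.1 j.2 ⟨n, R, x⟩ (hj.1 (Finset.mem_singleton_self _))
  have hcon : ∀ p : HC.{u}, Pow.mk W (k (Pow.mk U fun _ => p)) = Pow.mk W fun _ => p := by
    intro p
    refine Pow.mk_eq_mk.2 (Ultrafilter.of_le _ ?_)
    filter_upwards [eventually_ge_atTop ((∅, {p}) : J)] with j hj
    exact hG j.1 j.2 p (hj.2 (Finset.mem_singleton_self _))
  have hrel' : ∀ {n : ℕ} (R : starLang.Relations n)
      (x : Fin n → Pow.{u} U),
      Structure.RelMap R (fun i => Pow.mk W (k (x i))) ↔ Structure.RelMap R x := by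
    intro n R x
    rw [Pow.relMap_mk]
    constructor
    · intro h'
      obtain ⟨j, h1, h2⟩ := (h'.and (hrel R x)).exists
      exact h2.1 h1
    · intro h'
      filter_upwards [hrel R x] with j hj
      exact hj.2 h'
  refine ⟨J, W, ⟨⟨fun m => Pow.mk W (k m), ?_⟩, ?_, ?_⟩, k (Pow.mk U a), rfl,
    fun j => hU j.1 j.2⟩
  · intro m m' hm
    obtain ⟨y, rfl⟩ := Pow.mk_surjective m
    obtain ⟨z, rfl⟩ := Pow.mk_surjective m'
    -- Equality is itself one of the preserved relations, which gives injectivity.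
    have h1 := hrel' eqStar fun i => Pow.mk U (![y, z] i)
    rw [Pow.relMap_mk, Pow.relMap_mk] at h1
    simp only [relMap_eqStar] at h1
    exact Pow.mk_eq_mk.2 (h1.1 (Pow.mk_eq_mk.1 hm))
  · intro n g x
    obtain ⟨p, hp⟩ := exists_funMap_eq g
    rw [Pow.funMap_eq hp, Pow.funMap_eq hp]
    exact hcon p
  · intro n R x
    rcases R with R | R
    · exact hrel' R x
    · exact Empty.elim R

end HC

theorem mainTheorem6 : ¬ IsModelComplete theoryHC.{u} := by
  intro hmc
  obtain ⟨I, U, a, ha, hgen⟩ := HC.exists_generic.{u}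
  obtain ⟨J, W, g, b, hgb, hb⟩ := HC.exists_embedding a hgen
  obtain ⟨φ, hφ⟩ := HC.dfn_univ.{u}
  have hM : g.toHom.range ⊨ theoryHC.{u} := by
    have := HC.Pow.models.{u} U
    exact StrongHomClass.theory_model g.equivRange
  have hne : Nonempty g.toHom.range := g.equivRange.toEquiv.nonempty_congr.1 inferInstance
  have hel : g.toHom.range.IsElementary :=
    hmc (HC.Pow.{u} W) g.toHom.range (HC.Pow.models W) hM
  -- The truth of `φ` in `H_{ω₁}` depends on variable `0` only, so all variables may be merged into
  -- one to obtain a formula in finitely many variables.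
  have h := hel (φ.relabel fun _ => (0 : Fin 1)) fun _ => g.equivRange (HC.Pow.mk U a)
  rw [Formula.realize_relabel, Formula.realize_relabel] at h
  have hN : φ.Realize fun _ => HC.Pow.mk W b :=
    (HC.Pow.realize_mk φ fun _ => b).2 (Filter.Eventually.of_forall fun j => (hφ _).2 (hb j))
  have hM' : φ.Realize fun _ : ℕ => g.equivRange (HC.Pow.mk U a) := by
    refine h.1 ?_
    rw [← hgb] at hN
    exact hN
  have hM'' : φ.Realize fun _ : ℕ => HC.Pow.mk U a :=
    (StrongHomClass.realize_formula g.equivRange φ).1 hM'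
  obtain ⟨i, hi⟩ := ((HC.Pow.realize_mk φ fun _ => a).1 hM'').exists
  exact ha i ((hφ _).1 hi)
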